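/- Let $M\in\mathbb{R}^{d\times d}$ have no eigenvalues on the imaginary axis. Consider the controlled diffusion $$X_t = X_0+\int_0^t\bigl(MX_s+v(X_s)\bigr)\,ds+W_t,\qquad t\ge 0,\qquad(\ast)$$ where $W$ is a standard Brownian motion in $\mathbb{R}^d$. Let $\overline{\mathfrak U}$ be the class of Borel measurable, locally bounded maps $v:\mathbb{R}^d\to\mathbb{R}^d$ (stationary Markov controls) under which $(\ast)$ has, from every deterministic initial point, a unique strong solution for all $t\ge 0$, the solution is positive recurrent (from every initial point, every bounded domain is reached in finite expected time), and $$\frac12\int_{\mathbb{R}^d}|v(x)|^2\,\mu_v(dx)<\infty,$$ where $\mu_v$ denotes the associated invariant probability measure. Then there is a constant $\widetilde C_0<\infty$ depending only on $M$ such that $$\int_{\mathbb{R}^d}|x|^2\,\mu_v(dx)\;\le\;\widetilde C_0\Bigl(1+\int_{\mathbb{R}^d}|v(x)|^2\,\mu_v(dx)\Bigr)\qquad\text{for all } v\in\overline{\mathfrak U}.$$ -/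

import Mathlib

open MeasureTheory ProbabilityTheory
open scoped NNReal ENNReal

namespace LQG

/-- `ℝ^d` with its Euclidean norm. -/
abbrev E (d : ℕ) : Type := EuclideanSpace ℝ (Fin d)

/-- A real square matrix is exponentially dichotomous if it has no (complex) eigenvalue on the
imaginary axis. -/
def IsExponentiallyDichotomous {d : ℕ} (M : Matrix (Fin d) (Fin d) ℝ) : Prop :=
  ∀ z ∈ spectrum ℂ (M.map (algebraMap ℝ ℂ)), z.re ≠ 0

section Diffusion

variable {Ω : Type*} [MeasurableSpace Ω] {d : ℕ}

/-- The σ-algebra `σ(W_r : r ≤ t)` generated by the process `W` up to time `t`. -/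
abbrev past (W : ℝ≥0 → Ω → E d) (t : ℝ≥0) : MeasurableSpace Ω :=
  ⨆ r : ℝ≥0, ⨆ _ : r ≤ t, MeasurableSpace.comap (W r) inferInstance

/-- `W` is a standard Brownian motion in `ℝ^d` under `P`: it starts at `0`, has almost surely
continuous paths, and for `s ≤ t` the increment `W_t - W_s` is independent of `σ(W_r : r ≤ s)` and
has law `N(0, (t - s) I)`. -/
structure IsBrownianMotion (P : Measure Ω) (W : ℝ≥0 → Ω → E d) : Prop where
  measurable : ∀ t, Measurable (W t)
  zero : ∀ᵐ ω ∂P, W 0 ω = 0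
  continuous : ∀ᵐ ω ∂P, Continuous fun t => W t ω
  indep : ∀ s t : ℝ≥0, s ≤ t →
    Indep (past W s) (MeasurableSpace.comap (fun ω => W t ω - W s ω) inferInstance) P
  law : ∀ s t : ℝ≥0, s ≤ t →
    HasLaw (fun ω => W t ω - W s ω)
      ((stdGaussian (E d)).map fun z => Real.sqrt ((t : ℝ) - (s : ℝ)) • z) P

/-- The controlled drift `x ↦ M x + v(x)`. -/
noncomputable def drift (M : Matrix (Fin d) (Fin d) ℝ) (v : E d → E d) (x : E d) : E d :=
  Matrix.toEuclideanLin M x + v x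

/-- `X` is a strong solution of `dX = (M X + v(X)) dt + dW`, `X_0 = x`, on `[0, ∞)`:
`X_t` is measurable with respect to the `P`-completion of `σ(W_r : r ≤ t)` (that is, it agrees
almost surely with a `σ(W_r : r ≤ t)`-measurable random variable), and almost surely the path is
continuous and satisfies the integral equation for all `t ≥ 0`. -/
structure IsStrongSolution (P : Measure Ω) (W : ℝ≥0 → Ω → E d) (M : Matrix (Fin d) (Fin d) ℝ)
    (v : E d → E d) (x : E d) (X : ℝ≥0 → Ω → E d) : Prop where
  adapted : ∀ t, AEStronglyMeasurable[past W t] (X t) P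
  continuous : ∀ᵐ ω ∂P, Continuous fun t => X t ω
  equation : ∀ᵐ ω ∂P, ∀ t : ℝ≥0,
    X t ω = x + (∫ s in (0 : ℝ)..(t : ℝ), drift M v (X s.toNNReal ω)) + W t ω

/-- From every initial point there is a strong solution for all times, and it is unique up to
indistinguishability. -/
def HasUniqueStrongSolution (P : Measure Ω) (W : ℝ≥0 → Ω → E d) (M : Matrix (Fin d) (Fin d) ℝ)
    (v : E d → E d) : Prop :=
  ∀ x : E d, ∃ X, IsStrongSolution P W M v x X ∧
    ∀ Y, IsStrongSolution P W M v x Y → ∀ᵐ ω ∂P, ∀ t, Y t ω = X t ω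

/-- The first time at which the path `t ↦ X_t(ω)` is in `D` (`∞` if there is none). -/
noncomputable def hittingTime (X : ℝ≥0 → Ω → E d) (D : Set (E d)) (ω : Ω) : ℝ≥0∞ :=
  ⨅ (t : ℝ≥0) (_ : X t ω ∈ D), (t : ℝ≥0∞)

/-- Positive recurrence: from every initial point, every bounded domain (nonempty connected open
set) is reached in finite expected time. -/
def IsPositiveRecurrent (P : Measure Ω) (W : ℝ≥0 → Ω → E d) (M : Matrix (Fin d) (Fin d) ℝ)
    (v : E d → E d) : Prop :=
  ∀ D : Set (E d), IsOpen D → IsConnected D → Bornology.IsBounded D →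
    ∀ x X, IsStrongSolution P W M v x X → ∫⁻ ω, hittingTime X D ω ∂P < ∞

/-- `μ` is an invariant probability measure of the controlled diffusion:
`∫ P_x(X_t ∈ A) μ(dx) = μ(A)` for all `t ≥ 0` and all Borel sets `A`, where `P_x(X_t ∈ ·)` is the
law at time `t` of the solution started at `x`.
(`Measure.bind` is `0`, hence not a probability measure, unless the law of `X_t` depends
measurably on `x`, up to a `μ`-null set.) -/
def IsInvariantProbability (P : Measure Ω) (W : ℝ≥0 → Ω → E d) (M : Matrix (Fin d) (Fin d) ℝ)
    (v : E d → E d) (μ : Measure (E d)) : Prop :=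
  IsProbabilityMeasure μ ∧
    ∀ X : E d → ℝ≥0 → Ω → E d, (∀ x, IsStrongSolution P W M v x (X x)) →
      ∀ t : ℝ≥0, μ.bind (fun x => P.map (X x t)) = μ

/-- The control effort `½ ∫ |v|² dμ`. -/
noncomputable def effort (v : E d → E d) (μ : Measure (E d)) : ℝ≥0∞ :=
  2⁻¹ * ∫⁻ x, ‖v x‖ₑ ^ 2 ∂μ

/-- The class of stabilising controls: locally bounded (Borel) stationary Markov controls `v` under
which the diffusion has a unique strong solution, is positive recurrent, and has finite control
effort with respect to its invariant probability measure. -/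
structure IsStabilisingControl (P : Measure Ω) (W : ℝ≥0 → Ω → E d)
    (M : Matrix (Fin d) (Fin d) ℝ) (v : E d → E d) : Prop where
  measurable : Measurable v
  locallyBounded : ∀ R : ℝ, ∃ K : ℝ, ∀ x, ‖x‖ ≤ R → ‖v x‖ ≤ K
  uniqueSolution : HasUniqueStrongSolution P W M v
  positiveRecurrent : IsPositiveRecurrent P W M v
  finiteEffort : ∀ μ, IsInvariantProbability P W M v μ → effort v μ < ∞

end Diffusion

end LQG

/-! A linear functional `l` with `l (M x + v x) = lam * l x + u x` turns the diffusion into a scalar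
linear equation driven by `u(X)` and the noise `l(W)`. Since `lam.re ≠ 0`, this equation contracts
in one direction of time: solving it forwards if `lam.re < 0` and backwards if `lam.re > 0`
expresses `l(X)` at one end of `[0, t]` as a factor of modulus `exp (-|lam.re| t)` times `l(X)` at
the other end, plus an error. Averaged over an invariant start, the error has mean square bounded
uniformly in `t` by a constant times `∫ |u|² dμ + const`. Both ends have law `μ`, so letting `t → ∞`
bounds `∫ |l|² dμ` (`IsInvariantProbability.lintegral_functional_sq_le`).

The second moment is not known to be finite beforehand, so the comparison is made for `min (|l|²)
N`, with `t → ∞` before `N → ∞` (`lintegral_enorm_sq_le_of_truncated`). Integrating by parts in the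
variation of constants formula makes it pathwise, so no stochastic integral is needed.

Generalized left eigenvectors of `M` are treated by going up a Jordan chain, where `u` is the
preceding functional plus `l ∘ v` (`mem_boundedFunctionals_of_dualEnd`). They span all functionals,
in particular the coordinates. -/

namespace LQG

/-! ### Elementary square inequalities -/

/-- The Cauchy-Schwarz inequality `(∫ f dν)² ≤ ν(univ) ∫ f² dν`. -/
lemma sq_lintegral_le {α : Type*} [MeasurableSpace α] (ν : Measure α) {f : α → ℝ≥0∞}
    (hf : AEMeasurable f ν) : (∫⁻ a, f a ∂ν) ^ 2 ≤ ν Set.univ * ∫⁻ a, f a ^ 2 ∂ν := by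
  have h := ENNReal.lintegral_mul_le_Lp_mul_Lq ν Real.HolderConjugate.two_two
    (f := fun _ => 1) (g := f) aemeasurable_const hf
  simp only [Pi.mul_apply, one_mul, lintegral_const, one_pow, ENNReal.rpow_ofNat] at h
  calc (∫⁻ a, f a ∂ν) ^ 2
      ≤ (ν Set.univ ^ (1 / 2 : ℝ) * (∫⁻ a, f a ^ 2 ∂ν) ^ (1 / 2 : ℝ)) ^ 2 := by gcongr
    _ = ν Set.univ * ∫⁻ a, f a ^ 2 ∂ν := by
      rw [mul_pow, ← ENNReal.rpow_natCast, ← ENNReal.rpow_natCast, ← ENNReal.rpow_mul,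
        ← ENNReal.rpow_mul]
      norm_num

/-- The weighted Cauchy-Schwarz inequality `(∫ k f dν)² ≤ ∫ k dν ∫ k f² dν`. -/
lemma sq_lintegral_mul_le {α : Type*} [MeasurableSpace α] (ν : Measure α) {k f : α → ℝ≥0∞}
    (hk : Measurable k) (hf : Measurable f) :
    (∫⁻ a, k a * f a ∂ν) ^ 2 ≤ (∫⁻ a, k a ∂ν) * ∫⁻ a, k a * f a ^ 2 ∂ν := by
  have h := sq_lintegral_le (ν.withDensity k) hf.aemeasurable
  rw [lintegral_withDensity_eq_lintegral_mul _ hk hf,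
    lintegral_withDensity_eq_lintegral_mul _ hk (hf.pow_const 2),
    withDensity_apply _ MeasurableSet.univ, Measure.restrict_univ] at h
  exact h

lemma ennreal_add_sq_le (a b : ℝ≥0∞) : (a + b) ^ 2 ≤ 2 * a ^ 2 + 2 * b ^ 2 := by
  have h := ENNReal.rpow_add_le_mul_rpow_add_rpow a b (p := 2) (by norm_num)
  norm_num at h
  rwa [mul_add] at h

lemma enorm_add_sq_le {F : Type*} [NormedAddCommGroup F] (a b : F) :
    ‖a + b‖ₑ ^ 2 ≤ 2 * ‖a‖ₑ ^ 2 + 2 * ‖b‖ₑ ^ 2 :=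
  (by gcongr; exact enorm_add_le a b : ‖a + b‖ₑ ^ 2 ≤ (‖a‖ₑ + ‖b‖ₑ) ^ 2).trans
    (ennreal_add_sq_le _ _)

/-! ### Pathwise variation of constants -/

/-- The forcing of the scalar linear equation `dy = lam * y dt + dg` satisfied by a path `y`. -/
noncomputable def forcing (lam : ℂ) (y : ℝ → ℂ) (t : ℝ) : ℂ :=
  y t - y 0 - lam * ∫ r in (0 : ℝ)..t, y r

lemma continuous_forcing (lam : ℂ) {y : ℝ → ℂ} (hy : Continuous y) :
    Continuous (forcing lam y) := by
  have : Continuous fun t => ∫ r in (0 : ℝ)..t, y r :=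
    intervalIntegral.continuous_primitive (fun a b => hy.intervalIntegrable a b) 0
  unfold forcing
  fun_prop

/-- Variation of constants, with the stochastic integral integrated by parts. -/
lemma exp_mul_sub_eq_forcing (lam : ℂ) {y : ℝ → ℂ} (hy : Continuous y) (t : ℝ) :
    Complex.exp (-lam * t) * y t - y 0 = Complex.exp (-lam * t) * forcing lam y t +
      ∫ s in (0 : ℝ)..t, lam * (Complex.exp (-lam * s) * forcing lam y s) := by
  have hg := continuous_forcing lam hy
  -- `y` is only continuous, so the function differentiated is `exp (-lam s) * (y s - forcing s)`,
  -- which involves `y` only through its primitive.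
  have hderiv : ∀ s : ℝ, HasDerivAt
      (fun s : ℝ => Complex.exp (-lam * s) * (lam * (∫ r in (0 : ℝ)..s, y r) + y 0))
      (lam * (Complex.exp (-lam * s) * forcing lam y s)) s := by
    intro s
    have h1 : HasDerivAt (fun s : ℝ => Complex.exp (-lam * s))
        (Complex.exp (-lam * s) * (-lam)) s := by
      have : HasDerivAt (fun s : ℝ => -lam * (s : ℂ)) (-lam) s := by
        simpa using (Complex.ofRealCLM.hasDerivAt (x := s)).const_mul (-lam)
      exact this.cexp
    have h2 : HasDerivAt (fun s : ℝ => lam * (∫ r in (0 : ℝ)..s, y r) + y 0) (lam * y s) s :=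
      ((intervalIntegral.integral_hasDerivAt_right (hy.intervalIntegrable _ _)
        hy.stronglyMeasurable.stronglyMeasurableAtFilter hy.continuousAt).const_mul lam).add_const _
    exact (h1.mul h2).congr_deriv (by unfold forcing; ring)
  have hint := intervalIntegral.integral_eq_sub_of_hasDerivAt (a := 0) (b := t)
    (fun s _ => hderiv s) (Continuous.intervalIntegrable (by fun_prop) _ _)
  rw [hint]
  simp only [forcing, intervalIntegral.integral_same]
  simp
  ring

lemma lintegral_exp_neg_le {c : ℝ} (hc : 0 < c) (S : Set ℝ) (hS : S ⊆ Set.Ioi 0) :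
    ∫⁻ s in S, ENNReal.ofReal (Real.exp (-c * s)) ≤ ENNReal.ofReal (1 / c) := by
  refine (lintegral_mono_set hS).trans_eq ?_
  rw [← ofReal_integral_eq_lintegral_ofReal (integrableOn_exp_mul_Ioi (by linarith) 0)
    (Filter.Eventually.of_forall fun _ => (Real.exp_pos _).le),
    integral_exp_mul_Ioi (by linarith) 0]
  simp [neg_div_neg_eq]

lemma enorm_exp_neg_mul (lam : ℂ) (s : ℝ) :
    ‖Complex.exp (-lam * s)‖ₑ = ENNReal.ofReal (Real.exp (-lam.re * s)) := by
  rw [← ofReal_norm, Complex.norm_exp]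
  simp

/-- With `0 < lam.re`, the value at time `0` is recovered from that at time `t` up to an
exponentially discounted forcing. -/
lemma enorm_sub_exp_mul_sq_le {lam : ℂ} (hlam : 0 < lam.re) {y : ℝ → ℂ} (hy : Continuous y)
    {t : ℝ} (ht : 0 ≤ t) :
    ‖y 0 - Complex.exp (-lam * t) * y t‖ₑ ^ 2 ≤
      2 * ENNReal.ofReal (Real.exp (-lam.re * t)) ^ 2 * ‖forcing lam y t‖ₑ ^ 2 +
      2 * (‖lam‖ₑ ^ 2 * ENNReal.ofReal (1 / lam.re)) * ∫⁻ s in Set.Ioc 0 t,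
        ENNReal.ofReal (Real.exp (-lam.re * s)) * ‖forcing lam y s‖ₑ ^ 2 := by
  have hg := continuous_forcing lam hy
  rw [← enorm_neg, neg_sub, exp_mul_sub_eq_forcing lam hy t]
  refine (enorm_add_sq_le _ _).trans ?_
  rw [enorm_mul, mul_pow, enorm_exp_neg_mul, ← mul_assoc, mul_assoc (2 : ℝ≥0∞) (_ * _)]
  gcongr
  rw [intervalIntegral.integral_of_le ht]
  calc ‖∫ s in Set.Ioc 0 t, lam * (Complex.exp (-lam * s) * forcing lam y s)‖ₑ ^ 2
      ≤ (∫⁻ s in Set.Ioc 0 t, ‖lam * (Complex.exp (-lam * s) * forcing lam y s)‖ₑ) ^ 2 := by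
        gcongr; exact enorm_integral_le_lintegral_enorm _
    _ = ‖lam‖ₑ ^ 2 * (∫⁻ s in Set.Ioc 0 t,
        ENNReal.ofReal (Real.exp (-lam.re * s)) * ‖forcing lam y s‖ₑ) ^ 2 := by
        simp_rw [enorm_mul, enorm_exp_neg_mul]
        rw [lintegral_const_mul _ (by fun_prop), mul_pow]
    _ ≤ _ := by
        rw [mul_assoc]
        gcongr
        -- The exponential serves as the weight: its mass is at most `1 / lam.re`, whatever `t` is.
        refine (sq_lintegral_mul_le _ (by fun_prop) (by fun_prop)).trans ?_
        gcongr
        exact lintegral_exp_neg_le hlam _ fun s hs => hs.1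

lemma measurable_uncurry_forcing {Ω : Type*} [MeasurableSpace Ω] (lam : ℂ) {y : ℝ → Ω → ℂ}
    (hyc : ∀ ω, Continuous fun t => y t ω) (hym : ∀ t, Measurable (y t)) :
    Measurable (Function.uncurry fun t ω => forcing lam (fun s => y s ω) t) := by
  have hjoint : Measurable (Function.uncurry y) :=
    measurable_uncurry_of_continuous_of_measurable hyc hym
  refine measurable_uncurry_of_continuous_of_measurable
    (fun ω => continuous_forcing lam (hyc ω)) fun t => ?_
  have h1 : ∀ S : Set ℝ, Measurable fun ω => ∫ r in S, y r ω := fun S =>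
    (StronglyMeasurable.integral_prod_right (ν := volume.restrict S)
      (f := fun ω r => y r ω) (hjoint.comp measurable_swap).stronglyMeasurable).measurable
  unfold forcing
  simp_rw [intervalIntegral]
  exact ((hym t).sub (hym 0)).sub (((h1 _).sub (h1 _)).const_mul lam)

/-- Second moment bound for the solution of a scalar linear equation in terms of the second moments
of its forcing. -/
lemma lintegral_enorm_sub_exp_mul_sq_le {Ω : Type*} [MeasurableSpace Ω] (P : Measure Ω) [SFinite P]
    {lam : ℂ} (hlam : 0 < lam.re) {y : ℝ → Ω → ℂ}
    (hyc : ∀ ω, Continuous fun t => y t ω) (hym : ∀ t, Measurable (y t)) {t : ℝ} (ht : 0 ≤ t)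
    {D : ℝ → ℝ≥0∞}
    (hD : ∀ s, 0 ≤ s → s ≤ t → ∫⁻ ω, ‖forcing lam (fun r => y r ω) s‖ₑ ^ 2 ∂P ≤ D s) :
    ∫⁻ ω, ‖y 0 ω - Complex.exp (-lam * t) * y t ω‖ₑ ^ 2 ∂P ≤
      2 * ENNReal.ofReal (Real.exp (-lam.re * t)) ^ 2 * D t +
      2 * (‖lam‖ₑ ^ 2 * ENNReal.ofReal (1 / lam.re)) * ∫⁻ s in Set.Ioc 0 t,
        ENNReal.ofReal (Real.exp (-lam.re * s)) * D s := by
  have hm := measurable_uncurry_forcing lam hyc hym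
  have hmt : Measurable fun ω => forcing lam (fun r => y r ω) t :=
    hm.comp (measurable_const.prodMk measurable_id)
  refine (lintegral_mono fun ω => enorm_sub_exp_mul_sq_le hlam (hyc ω) ht).trans ?_
  rw [lintegral_add_left (by fun_prop), lintegral_const_mul _ (by fun_prop)]
  have hm2 : Measurable (Function.uncurry fun (ω : Ω) (s : ℝ) =>
      ENNReal.ofReal (Real.exp (-lam.re * s)) * ‖forcing lam (fun r => y r ω) s‖ₑ ^ 2) := by
    have : Measurable fun p : Ω × ℝ => forcing lam (fun r => y r p.1) p.2 :=
      hm.comp measurable_swap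
    unfold Function.uncurry
    fun_prop
  have hm3 : Measurable fun ω => ∫⁻ s in Set.Ioc 0 t,
      ENNReal.ofReal (Real.exp (-lam.re * s)) * ‖forcing lam (fun r => y r ω) s‖ₑ ^ 2 :=
    hm2.lintegral_prod_right'
  rw [lintegral_const_mul _ hm3,
    lintegral_lintegral_swap hm2.aemeasurable]
  refine add_le_add (mul_le_mul' le_rfl (hD t ht le_rfl)) (mul_le_mul' le_rfl ?_)
  · refine setLIntegral_mono' (μ := volume) (s := Set.Ioc 0 t) measurableSet_Ioc fun s hs => ?_
    have hms : Measurable fun ω => forcing lam (fun r => y r ω) s :=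
      hm.comp (measurable_const.prodMk measurable_id)
    rw [lintegral_const_mul _ (by fun_prop)]
    gcongr
    exact hD s hs.1.le hs.2

/-! ### Regular versions of processes and of transition laws -/

lemma measurable_of_dense_of_continuous {Ω β : Type*} [MeasurableSpace Ω] [TopologicalSpace β]
    [TopologicalSpace.PseudoMetrizableSpace β] [MeasurableSpace β] [BorelSpace β]
    {f : ℝ≥0 → Ω → β} (hc : ∀ ω, Continuous fun t => f t ω) {S : Set ℝ≥0} (hS : Dense S)
    (hm : ∀ t ∈ S, Measurable (f t)) (t : ℝ≥0) : Measurable (f t) := by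
  obtain ⟨u, huS, hut⟩ := mem_closure_iff_seq_limit.1 (hS t)
  exact measurable_of_tendsto_metrizable (fun n => hm (u n) (huS n))
    (tendsto_pi_nhds.2 fun ω => ((hc ω).tendsto t).comp hut)

/-- A process with almost surely continuous paths is indistinguishable from one whose paths are all
continuous and whose marginals are measurable. -/
lemma exists_continuous_measurable_modification {Ω F : Type*} [MeasurableSpace Ω] (P : Measure Ω)
    [TopologicalSpace F] [TopologicalSpace.PseudoMetrizableSpace F] [MeasurableSpace F]
    [BorelSpace F] [Nonempty F] {f : ℝ≥0 → Ω → F} (hm : ∀ t, AEMeasurable (f t) P)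
    (hc : ∀ᵐ ω ∂P, Continuous fun t => f t ω) :
    ∃ g : ℝ≥0 → Ω → F, (∀ ω, Continuous fun t => g t ω) ∧ (∀ t, Measurable (g t)) ∧
      ∀ᵐ ω ∂P, ∀ t, g t ω = f t ω := by
  classical
  obtain ⟨S, hSc, hSd⟩ := TopologicalSpace.exists_countable_dense ℝ≥0
  have hgood : ∀ᵐ ω ∂P, (Continuous fun t => f t ω) ∧ ∀ q ∈ S, f q ω = (hm q).mk _ ω :=
    hc.and ((ae_ball_iff hSc).2 fun q _ => (hm q).ae_eq_mk)
  -- A measurable null set containing all bad paths, so that redefining the process on it keeps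
  -- measurability.
  set N := toMeasurable P {ω | ¬((Continuous fun t => f t ω) ∧ ∀ q ∈ S, f q ω = (hm q).mk _ ω)}
    with hN
  have hN0 : P N = 0 := by rw [hN, measure_toMeasurable]; exact hgood
  have hNc : ∀ ω ∉ N, (Continuous fun t => f t ω) ∧ ∀ q ∈ S, f q ω = (hm q).mk _ ω := by
    intro ω hω
    by_contra h
    exact hω (subset_toMeasurable _ _ h)
  let a : F := Classical.arbitrary F
  let g : ℝ≥0 → Ω → F := fun t ω => if ω ∈ N then a else f t ω
  have hgc : ∀ ω, Continuous fun t => g t ω := by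
    intro ω
    by_cases h : ω ∈ N
    · simp only [g, h, if_true]; exact continuous_const
    · simp only [g, h, if_false]; exact (hNc ω h).1
  refine ⟨g, hgc, measurable_of_dense_of_continuous hgc hSd fun q hq => ?_, ?_⟩
  · have : g q = N.piecewise (fun _ => a) ((hm q).mk _) := by
      ext ω
      by_cases h : ω ∈ N
      · simp [g, h]
      · simp [g, h, (hNc ω h).2 q hq]
    rw [this]
    exact measurable_const.piecewise (measurableSet_toMeasurable _ _) (hm q).measurable_mk
  · filter_upwards [measure_eq_zero_iff_ae_notMem.1 hN0] with ω hω t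
    simp [g, hω]

/-- A weakly continuous family of probability kernels, each measurable almost everywhere, is almost
everywhere jointly measurable. -/
lemma exists_jointly_measurable_kernel {F : Type*} [TopologicalSpace F]
    [TopologicalSpace.PseudoMetrizableSpace F] [MeasurableSpace F] [BorelSpace F] [Nonempty F]
    {T : Type*} [MeasurableSpace T] (μ : Measure T)
    {κ : ℝ≥0 → T → Measure F} (hκp : ∀ t x, IsProbabilityMeasure (κ t x))
    (hm : ∀ t, AEMeasurable (κ t) μ)
    (hc : ∀ (g : BoundedContinuousFunction F ℝ≥0) x, Continuous fun t => ∫⁻ z, g z ∂κ t x) :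
    ∃ κ' : ℝ≥0 → T → Measure F, Measurable (Function.uncurry κ') ∧
      ∀ᵐ x ∂μ, ∀ t, κ' t x = κ t x := by
  classical
  obtain ⟨S, hSc, hSd⟩ := TopologicalSpace.exists_countable_dense ℝ≥0
  have hgood : ∀ᵐ x ∂μ, ∀ q ∈ S, κ q x = (hm q).mk _ x :=
    (ae_ball_iff hSc).2 fun q _ => (hm q).ae_eq_mk
  set N := toMeasurable μ {x | ¬ ∀ q ∈ S, κ q x = (hm q).mk _ x} with hN
  have hN0 : μ N = 0 := by rw [hN, measure_toMeasurable]; exact hgood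
  have hNc : ∀ x ∉ N, ∀ q ∈ S, κ q x = (hm q).mk _ x := by
    intro x hx
    by_contra h
    exact hx (subset_toMeasurable _ _ h)
  let a : Measure F := Measure.dirac (Classical.arbitrary F)
  let κ' : ℝ≥0 → T → Measure F := fun t x => if x ∈ N then a else κ t x
  have hκ'p : ∀ p, IsProbabilityMeasure (Function.uncurry κ' p) := by
    rintro ⟨t, x⟩
    by_cases h : x ∈ N
    · simp only [Function.uncurry, κ', h, if_true]; infer_instance
    · simp only [Function.uncurry, κ', h, if_false]; exact hκp t x
  have hκ'c : ∀ (g : BoundedContinuousFunction F ℝ≥0) x,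
      Continuous fun t => ∫⁻ z, g z ∂κ' t x := by
    intro g x
    by_cases h : x ∈ N
    · simp only [κ', h, if_true]; exact continuous_const
    · simp only [κ', h, if_false]; exact hc g x
  have hκ'm : ∀ q ∈ S, Measurable (κ' q) := by
    intro q hq
    have : κ' q = N.piecewise (fun _ => a) ((hm q).mk _) := by
      ext1 x
      by_cases h : x ∈ N
      · simp [κ', h]
      · simp [κ', h, hNc x h q hq]
    rw [this]
    exact measurable_const.piecewise (measurableSet_toMeasurable _ _) (hm q).measurable_mk
  have hint : ∀ g : BoundedContinuousFunction F ℝ≥0,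
      Measurable (Function.uncurry fun t x => ∫⁻ z, g z ∂κ' t x) := fun g =>
    measurable_uncurry_of_continuous_of_measurable (hκ'c g)
      (measurable_of_dense_of_continuous (hκ'c g) hSd fun q hq =>
        (Measure.measurable_lintegral (by fun_prop)).comp (hκ'm q hq))
  refine ⟨κ', ?_, ?_⟩
  -- Closed sets form a generating π-system, and their indicators are limits of bounded continuous
  -- functions, for which `hint` applies.
  · refine Measurable.measure_of_isPiSystem_of_isProbabilityMeasure (S := {s | IsClosed s})
      (by rw [BorelSpace.measurable_eq (α := F), borel_eq_generateFrom_isClosed])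
      isPiSystem_isClosed fun s hs => ?_
    refine measurable_of_tendsto_metrizable (fun n => hint (hs.apprSeq n))
      (tendsto_pi_nhds.2 fun p => ?_)
    exact HasOuterApproxClosed.tendsto_lintegral_apprSeq hs (Function.uncurry κ' p)
  · filter_upwards [measure_eq_zero_iff_ae_notMem.1 hN0] with x hx t
    simp [κ', hx]

/-- Bounded convergence along continuous paths; this supplies the weak continuity required by
`exists_jointly_measurable_kernel`. -/
lemma continuous_lintegral_map {Ω F : Type*} [MeasurableSpace Ω] (P : Measure Ω)
    [IsFiniteMeasure P] [TopologicalSpace F] [MeasurableSpace F] [OpensMeasurableSpace F]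
    {f : ℝ≥0 → Ω → F} (hc : ∀ ω, Continuous fun t => f t ω) (hm : ∀ t, Measurable (f t))
    (g : BoundedContinuousFunction F ℝ≥0) :
    Continuous fun t => ∫⁻ z, g z ∂(P.map (f t)) := by
  have hg : Measurable fun z => (g z : ℝ≥0∞) := by fun_prop
  have hgc : Continuous fun z => (g z : ℝ≥0∞) := ENNReal.continuous_coe.comp g.continuous
  simp_rw [lintegral_map hg (hm _)]
  refine continuous_iff_seqContinuous.2 fun u t hut => ?_
  refine tendsto_lintegral_of_dominated_convergence' (fun _ => (nndist 0 g : ℝ≥0∞))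
    (fun n => (hg.comp (hm _)).aemeasurable) (fun n => Filter.Eventually.of_forall fun ω => ?_)
    (by simp [ENNReal.mul_eq_top]) (Filter.Eventually.of_forall fun ω => ?_)
  · exact ENNReal.coe_le_coe.2 (g.apply_le_nndist_zero _)
  · exact ((hgc.comp (hc ω)).tendsto t).comp hut

/-! ### The forcing of a functional of the solution -/

lemma forcing_sub (lam : ℂ) {y : ℝ → ℂ} (hy : Continuous y) (s t : ℝ) :
    forcing lam y t - forcing lam y s = y t - y s - lam * ∫ r in s..t, y r := by
  rw [← intervalIntegral.integral_interval_sub_left (hy.intervalIntegrable 0 t)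
    (hy.intervalIntegrable 0 s)]
  unfold forcing
  ring

/-- Time reversal changes the sign of the eigenvalue, which reduces the stable case to the unstable
one. -/
lemma forcing_neg_reversed (lam : ℂ) {y : ℝ → ℂ} (hy : Continuous y) (s t : ℝ) :
    forcing (-lam) (fun r => y (t - r)) s = -(forcing lam y t - forcing lam y (t - s)) := by
  rw [forcing_sub lam hy]
  simp only [forcing, intervalIntegral.integral_comp_sub_left, sub_zero]
  ring

section Solution

variable {Ω : Type*} [MeasurableSpace Ω] {d : ℕ}

lemma intervalIntegrable_comp_of_locallyBounded {F : Type*} [NormedAddCommGroup F]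
    [MeasurableSpace F] [BorelSpace F] [SecondCountableTopology F]
    {h : E d → F} (hh : Measurable h)
    (hb : ∀ R : ℝ, ∃ K : ℝ, ∀ x, ‖x‖ ≤ R → ‖h x‖ ≤ K) {p : ℝ≥0 → E d} (hp : Continuous p)
    (s t : ℝ) : IntervalIntegrable (fun r : ℝ => h (p r.toNNReal)) volume s t := by
  have hq : Continuous fun r : ℝ => p r.toNNReal := hp.comp continuous_real_toNNReal
  obtain ⟨R, hR⟩ := (isCompact_uIcc (a := s) (b := t)).exists_bound_of_continuousOn hq.continuousOn
  obtain ⟨K, hK⟩ := hb R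
  rw [intervalIntegrable_iff]
  refine IntegrableOn.of_bound (C := K) (by simp)
    (hh.comp hq.measurable).aestronglyMeasurable ?_
  filter_upwards [ae_restrict_mem measurableSet_uIoc] with r hr
  exact hK _ (hR r (Set.uIoc_subset_uIcc hr))

/-- The forcing of the linear equation solved by `ℓ(X)` consists of the drift that is not accounted
for by the eigenvalue and of the noise. -/
lemma forcing_sub_eq {M : Matrix (Fin d) (Fin d) ℝ} {v : E d → E d} (hv : Measurable v)
    (hvb : ∀ R : ℝ, ∃ K : ℝ, ∀ x, ‖x‖ ≤ R → ‖v x‖ ≤ K) {l : E d →L[ℝ] ℂ} {lam : ℂ} {u : E d → ℂ}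
    (hu : ∀ x, l (drift M v x) = lam * l x + u x)
    {x : E d} {p w : ℝ≥0 → E d} (hp : Continuous p)
    (heq : ∀ t : ℝ≥0, p t = x + (∫ s in (0 : ℝ)..(t : ℝ), drift M v (p s.toNNReal)) + w t)
    {s t : ℝ} (hs : 0 ≤ s) (hst : s ≤ t) :
    forcing lam (fun r => l (p r.toNNReal)) t - forcing lam (fun r => l (p r.toNNReal)) s =
      (∫ r in s..t, u (p r.toNNReal)) + l (w t.toNNReal - w s.toNNReal) := by
  have hq : Continuous fun r : ℝ => l (p r.toNNReal) :=
    l.continuous.comp (hp.comp continuous_real_toNNReal)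
  have hMc : Continuous fun z : E d => Matrix.toEuclideanLin M z :=
    LinearMap.continuous_of_finiteDimensional _
  have hdm : Measurable (drift M v) := hMc.measurable.add hv
  have hdb : ∀ R : ℝ, ∃ K : ℝ, ∀ x, ‖x‖ ≤ R → ‖drift M v x‖ ≤ K := by
    intro R
    obtain ⟨K, hK⟩ := hvb R
    obtain ⟨C, hC⟩ := (isCompact_closedBall (0 : E d) R).exists_bound_of_continuousOn
      hMc.continuousOn
    exact ⟨C + K, fun x hx => (norm_add_le _ _).trans
      (add_le_add (hC x (by simpa using hx)) (hK x hx))⟩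
  have hdi := fun a b => intervalIntegrable_comp_of_locallyBounded hdm hdb hp a b
  have hX : p t.toNNReal - p s.toNNReal =
      (∫ r in s..t, drift M v (p r.toNNReal)) + (w t.toNNReal - w s.toNNReal) := by
    rw [heq t.toNNReal, heq s.toNNReal, Real.coe_toNNReal _ hs, Real.coe_toNNReal _ (hs.trans hst),
      ← intervalIntegral.integral_interval_sub_left (hdi 0 t) (hdi 0 s)]
    abel
  have hint : ∫ r in s..t, u (p r.toNNReal) =
      (∫ r in s..t, l (drift M v (p r.toNNReal))) - lam * ∫ r in s..t, l (p r.toNNReal) := by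
    have h1 : IntervalIntegrable (fun r : ℝ => l (drift M v (p r.toNNReal))) volume s t :=
      ⟨l.integrable_comp (hdi s t).1, l.integrable_comp (hdi s t).2⟩
    rw [← intervalIntegral.integral_const_mul, ← intervalIntegral.integral_sub h1
      ((hq.const_mul lam).intervalIntegrable s t)]
    simp [hu]
  rw [forcing_sub lam hq, ← map_sub, hX, map_add, hint,
    l.intervalIntegral_comp_comm (hdi s t)]
  ring

/-- The mean square of the increments of the forcing. -/
lemma lintegral_forcing_sub_sq_le {P : Measure Ω} [IsProbabilityMeasure P]
    {W : ℝ≥0 → Ω → E d} (hWm : ∀ t, Measurable (W t))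
    {M : Matrix (Fin d) (Fin d) ℝ} {v : E d → E d} (hv : Measurable v)
    (hvb : ∀ R : ℝ, ∃ K : ℝ, ∀ x, ‖x‖ ≤ R → ‖v x‖ ≤ K) {l : E d →L[ℝ] ℂ} {lam : ℂ} {u : E d → ℂ}
    (hum : Measurable u) (hu : ∀ x, l (drift M v x) = lam * l x + u x) {κ : ℝ≥0∞}
    (hκ : ∀ s t : ℝ≥0, s ≤ t →
      ∫⁻ ω, ‖l (W t ω - W s ω)‖ₑ ^ 2 ∂P ≤ κ * ENNReal.ofReal ((t : ℝ) - s))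
    {x : E d} {X : ℝ≥0 → Ω → E d} (hXc : ∀ ω, Continuous fun t => X t ω)
    (hXm : ∀ t, Measurable (X t))
    (heq : ∀ᵐ ω ∂P, ∀ t : ℝ≥0,
      X t ω = x + (∫ s in (0 : ℝ)..(t : ℝ), drift M v (X s.toNNReal ω)) + W t ω)
    {s t : ℝ} (hs : 0 ≤ s) (hst : s ≤ t) :
    ∫⁻ ω, ‖forcing lam (fun r => l (X r.toNNReal ω)) t -
        forcing lam (fun r => l (X r.toNNReal ω)) s‖ₑ ^ 2 ∂P ≤
      2 * (ENNReal.ofReal (t - s) * ∫⁻ r in Set.Ioc s t, ∫⁻ ω, ‖u (X r.toNNReal ω)‖ₑ ^ 2 ∂P) +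
        2 * (κ * ENNReal.ofReal (t - s)) := by
  have hX : Measurable (Function.uncurry X) := measurable_uncurry_of_continuous_of_measurable hXc hXm
  have hXr : Measurable fun q : Ω × ℝ => X q.2.toNNReal q.1 :=
    hX.comp ((measurable_real_toNNReal.comp measurable_snd).prodMk measurable_fst)
  have huX : Measurable (Function.uncurry fun (ω : Ω) (r : ℝ) => ‖u (X r.toNNReal ω)‖ₑ ^ 2) :=
    (hum.comp hXr).enorm.pow_const 2
  calc _ ≤ ∫⁻ ω, (2 * (ENNReal.ofReal (t - s) *
          ∫⁻ r in Set.Ioc s t, ‖u (X r.toNNReal ω)‖ₑ ^ 2) +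
          2 * ‖l (W t.toNNReal ω - W s.toNNReal ω)‖ₑ ^ 2) ∂P := by
        refine lintegral_mono_ae ?_
        filter_upwards [heq] with ω hω
        rw [forcing_sub_eq hv hvb hu (hXc ω) hω hs hst]
        refine (enorm_add_sq_le _ _).trans ?_
        gcongr
        rw [intervalIntegral.integral_of_le hst]
        calc _ ≤ (∫⁻ r in Set.Ioc s t, ‖u (X r.toNNReal ω)‖ₑ) ^ 2 := by
              gcongr; exact enorm_integral_le_lintegral_enorm _
          _ ≤ _ := by
              refine (sq_lintegral_le _ ?_).trans_eq (by simp)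
              exact (hum.comp (hXr.comp measurable_prodMk_left)).enorm.aemeasurable
    _ = 2 * (ENNReal.ofReal (t - s) *
          ∫⁻ r in Set.Ioc s t, ∫⁻ ω, ‖u (X r.toNNReal ω)‖ₑ ^ 2 ∂P) +
          2 * ∫⁻ ω, ‖l (W t.toNNReal ω - W s.toNNReal ω)‖ₑ ^ 2 ∂P := by
        have h1 : Measurable fun ω => ‖l (W t.toNNReal ω - W s.toNNReal ω)‖ₑ ^ 2 :=
          (l.continuous.measurable.comp ((hWm _).sub (hWm _))).enorm.pow_const 2
        have h2 : Measurable fun ω => ∫⁻ r in Set.Ioc s t, ‖u (X r.toNNReal ω)‖ₑ ^ 2 :=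
          huX.lintegral_prod_right'
        rw [lintegral_add_right _ (h1.const_mul 2), lintegral_const_mul _ h1,
          lintegral_const_mul _ (h2.const_mul _), lintegral_const_mul _ h2,
          lintegral_lintegral_swap huX.aemeasurable]
    _ ≤ _ := by
        gcongr
        refine (hκ _ _ (Real.toNNReal_le_toNNReal hst)).trans_eq ?_
        rw [Real.coe_toNNReal _ hs, Real.coe_toNNReal _ (hs.trans hst)]

end Solution

/-! ### Mean square estimates uniform in time -/

section Solution

variable {Ω : Type*} [MeasurableSpace Ω] {d : ℕ}

/-- The bound `D` on the mean square of the forcing, propagated through the variation of constants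
formula for an eigenvalue of modulus `m` at distance `c` from the imaginary axis. -/
noncomputable def propagated (m : ℝ≥0∞) (c t : ℝ) (D : ℝ → ℝ≥0∞) : ℝ≥0∞ :=
  2 * ENNReal.ofReal (Real.exp (-c * t)) ^ 2 * D t +
    2 * (m ^ 2 * ENNReal.ofReal (1 / c)) * ∫⁻ s in Set.Ioc 0 t,
      ENNReal.ofReal (Real.exp (-c * s)) * D s

/-- The one-step mean square estimate, forwards in time for eigenvalues in the left half-plane and
backwards in time for those in the right half-plane. -/
lemma exists_mean_square_bound {P : Measure Ω} [IsProbabilityMeasure P]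
    {W : ℝ≥0 → Ω → E d} (hWm : ∀ t, Measurable (W t))
    {M : Matrix (Fin d) (Fin d) ℝ} {v : E d → E d} (hv : Measurable v)
    (hvb : ∀ R : ℝ, ∃ K : ℝ, ∀ x, ‖x‖ ≤ R → ‖v x‖ ≤ K) {l : E d →L[ℝ] ℂ} {lam : ℂ}
    (hlam : lam.re ≠ 0) {u : E d → ℂ}
    (hum : Measurable u) (hu : ∀ x, l (drift M v x) = lam * l x + u x) {κ : ℝ≥0∞}
    (hκ : ∀ s t : ℝ≥0, s ≤ t →
      ∫⁻ ω, ‖l (W t ω - W s ω)‖ₑ ^ 2 ∂P ≤ κ * ENNReal.ofReal ((t : ℝ) - s))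
    {t : ℝ} (ht : 0 ≤ t) :
    ∃ (a b : ℝ≥0) (e : ℂ) (J : ℝ → Set ℝ), ‖e‖ₑ = ENNReal.ofReal (Real.exp (-|lam.re| * t)) ∧
      MeasurableSet {p : ℝ × ℝ | p.2 ∈ J p.1} ∧ (∀ s, volume (J s) ≤ ENNReal.ofReal s) ∧
      ∀ (x : E d) (X : ℝ≥0 → Ω → E d), (∀ ω, Continuous fun t => X t ω) →
        (∀ t, Measurable (X t)) →
        (∀ᵐ ω ∂P, ∀ t : ℝ≥0,
          X t ω = x + (∫ s in (0 : ℝ)..(t : ℝ), drift M v (X s.toNNReal ω)) + W t ω) →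
        ∫⁻ ω, ‖l (X a ω) - e * l (X b ω)‖ₑ ^ 2 ∂P ≤ propagated ‖lam‖ₑ |lam.re| t fun s =>
          2 * (ENNReal.ofReal s * ∫⁻ r in J s, ∫⁻ ω, ‖u (X r.toNNReal ω)‖ₑ ^ 2 ∂P) +
            2 * (κ * ENNReal.ofReal s) := by
  rcases hlam.lt_or_gt with hneg | hpos
  -- Stable direction: the path is read backwards from time `t`, so the forcing windows end at `t`.
  · refine ⟨t.toNNReal, 0, Complex.exp (lam * t), fun s => Set.Ioc (t - s) t, ?_, ?_, ?_, ?_⟩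
    · rw [abs_of_neg hneg, ← neg_neg lam, enorm_exp_neg_mul]; simp
    · exact (measurableSet_lt (f := fun p : ℝ × ℝ => t - p.1) (by fun_prop) measurable_snd).inter
        (measurableSet_le measurable_snd measurable_const)
    · intro s; simp
    · intro x X hXc hXm heq
      rw [abs_of_neg hneg]
      have hlc : ∀ ω, Continuous fun r : ℝ => l (X r.toNNReal ω) := fun ω =>
        l.continuous.comp ((hXc ω).comp continuous_real_toNNReal)
      have h := lintegral_enorm_sub_exp_mul_sq_le P (lam := -lam) (by simpa using hneg)
        (y := fun s ω => l (X (t - s).toNNReal ω))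
        (fun ω => (hlc ω).comp (continuous_const.sub continuous_id))
        (fun s => l.continuous.measurable.comp (hXm _)) ht
        (D := fun s => 2 * (ENNReal.ofReal s *
          ∫⁻ r in Set.Ioc (t - s) t, ∫⁻ ω, ‖u (X r.toNNReal ω)‖ₑ ^ 2 ∂P) +
            2 * (κ * ENNReal.ofReal s)) (fun s hs hst => ?_)
      · simpa [propagated] using h
      · have h2 := lintegral_forcing_sub_sq_le hWm hv hvb hum hu hκ hXc hXm heq
          (sub_nonneg.2 hst) (sub_le_self t hs)
        simp only [sub_sub_cancel] at h2
        refine le_trans (le_of_eq (lintegral_congr fun ω => ?_)) h2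
        rw [forcing_neg_reversed lam (hlc ω), enorm_neg]
  -- Unstable direction: time runs normally and the windows start at `0`.
  · refine ⟨0, t.toNNReal, Complex.exp (-lam * t), fun s => Set.Ioc 0 s, ?_, ?_, ?_, ?_⟩
    · rw [abs_of_pos hpos, enorm_exp_neg_mul]
    · exact (measurableSet_lt measurable_const measurable_snd).inter
        (measurableSet_le measurable_snd measurable_fst)
    · intro s; simp
    · intro x X hXc hXm heq
      rw [abs_of_pos hpos]
      have hlc : ∀ ω, Continuous fun r : ℝ => l (X r.toNNReal ω) := fun ω =>
        l.continuous.comp ((hXc ω).comp continuous_real_toNNReal)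
      have h := lintegral_enorm_sub_exp_mul_sq_le P hpos
        (y := fun s ω => l (X s.toNNReal ω)) hlc
        (fun s => l.continuous.measurable.comp (hXm _)) ht
        (D := fun s => 2 * (ENNReal.ofReal s *
          ∫⁻ r in Set.Ioc 0 s, ∫⁻ ω, ‖u (X r.toNNReal ω)‖ₑ ^ 2 ∂P) +
            2 * (κ * ENNReal.ofReal s)) (fun s hs hst => ?_)
      · simpa [propagated] using h
      · have h2 := lintegral_forcing_sub_sq_le hWm hv hvb hum hu hκ hXc hXm heq le_rfl hs
        simp only [sub_zero] at h2
        refine le_trans (le_of_eq (lintegral_congr fun ω => ?_)) h2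
        simp [forcing]

/-- A constant that dominates `propagated` uniformly in time for forcings of mean square
`O(t + t²)`. -/
noncomputable def propagationConst (m : ℝ≥0∞) (c : ℝ) : ℝ≥0∞ :=
  2 * (2 * ENNReal.ofReal (2 / c + 16 / c ^ 2)) +
    2 * (m ^ 2 * ENNReal.ofReal (1 / c)) *
      (2 * ENNReal.ofReal (2 / c + 16 / c ^ 2) * ENNReal.ofReal (1 / (c / 2)))

lemma propagationConst_lt_top {m : ℝ≥0∞} (hm : m ≠ ∞) (c : ℝ) : propagationConst m c < ∞ := by
  unfold propagationConst
  finiteness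

/-- The drift contributes `s²` and the noise `s`. Both are absorbed by an exponential at half the
decay rate `c`, so the discount `exp (-c s)` still leaves an integrable `exp (-c s / 2)`. -/
lemma linear_quadratic_le_exp {c : ℝ} (hc : 0 < c) {s : ℝ} (hs : 0 ≤ s) (A κ : ℝ≥0∞) :
    2 * (ENNReal.ofReal s * (A * ENNReal.ofReal s)) + 2 * (κ * ENNReal.ofReal s) ≤
      2 * ENNReal.ofReal (2 / c + 16 / c ^ 2) * ENNReal.ofReal (Real.exp (c / 2 * s)) *
        (A + κ) := by
  have he := Real.exp_pos (c / 2 * s)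
  have h1 : s ≤ 2 / c * Real.exp (c / 2 * s) := by
    have := Real.add_one_le_exp (c / 2 * s)
    rw [div_mul_eq_mul_div, le_div_iff₀ hc]
    linarith
  -- The square of `c s / 4 ≤ exp (c s / 4)`.
  have h2 : s * s ≤ 16 / c ^ 2 * Real.exp (c / 2 * s) := by
    have h := Real.add_one_le_exp (c / 4 * s)
    have hp : 0 ≤ c / 4 * s := by positivity
    have : Real.exp (c / 2 * s) = Real.exp (c / 4 * s) * Real.exp (c / 4 * s) := by
      rw [← Real.exp_add]; ring_nf
    rw [this, div_mul_eq_mul_div, le_div_iff₀ (by positivity)]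
    nlinarith
  have h3 : 0 ≤ 2 / c * Real.exp (c / 2 * s) := by positivity
  have h4 : 0 ≤ 16 / c ^ 2 * Real.exp (c / 2 * s) := by positivity
  have k1 : ENNReal.ofReal s ≤
      ENNReal.ofReal (2 / c + 16 / c ^ 2) * ENNReal.ofReal (Real.exp (c / 2 * s)) := by
    rw [← ENNReal.ofReal_mul (by positivity)]
    exact ENNReal.ofReal_le_ofReal (by linarith)
  have k2 : ENNReal.ofReal s * ENNReal.ofReal s ≤
      ENNReal.ofReal (2 / c + 16 / c ^ 2) * ENNReal.ofReal (Real.exp (c / 2 * s)) := by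
    rw [← ENNReal.ofReal_mul hs, ← ENNReal.ofReal_mul (by positivity)]
    exact ENNReal.ofReal_le_ofReal (by linarith)
  calc _ = 2 * (ENNReal.ofReal s * ENNReal.ofReal s * A) + 2 * (ENNReal.ofReal s * κ) := by ring
    _ ≤ 2 * (ENNReal.ofReal (2 / c + 16 / c ^ 2) * ENNReal.ofReal (Real.exp (c / 2 * s)) * A) +
        2 * (ENNReal.ofReal (2 / c + 16 / c ^ 2) * ENNReal.ofReal (Real.exp (c / 2 * s)) * κ) := by
        gcongr
    _ = _ := by ring

lemma propagated_mono {m : ℝ≥0∞} {c t : ℝ} (ht : 0 ≤ t) {D D' : ℝ → ℝ≥0∞}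
    (h : ∀ s, 0 ≤ s → D s ≤ D' s) : propagated m c t D ≤ propagated m c t D' := by
  unfold propagated
  refine add_le_add (mul_le_mul' le_rfl (h t ht)) (mul_le_mul' le_rfl ?_)
  exact setLIntegral_mono' (μ := volume) (s := Set.Ioc 0 t) measurableSet_Ioc fun s hs =>
    mul_le_mul' le_rfl (h s hs.1.le)

lemma propagated_le {m : ℝ≥0∞} {c : ℝ} (hc : 0 < c) {t : ℝ} (ht : 0 ≤ t) (A κ : ℝ≥0∞) :
    propagated m c t (fun s => 2 * (ENNReal.ofReal s * (A * ENNReal.ofReal s)) +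
      2 * (κ * ENNReal.ofReal s)) ≤ propagationConst m c * (A + κ) := by
  refine (propagated_mono ht fun s hs => linear_quadratic_le_exp hc hs A κ).trans ?_
  unfold propagated propagationConst
  set b := ENNReal.ofReal (2 / c + 16 / c ^ 2)
  have h1 : ENNReal.ofReal (Real.exp (-c * t)) ^ 2 * ENNReal.ofReal (Real.exp (c / 2 * t)) ≤ 1 := by
    rw [← ENNReal.ofReal_pow (Real.exp_pos _).le, ← ENNReal.ofReal_mul (by positivity),
      ← Real.exp_nat_mul, ← Real.exp_add, ENNReal.ofReal_le_one, Real.exp_le_one_iff]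
    push_cast
    nlinarith [mul_nonneg hc.le ht]
  have h2 : ∫⁻ s in Set.Ioc 0 t, ENNReal.ofReal (Real.exp (-c * s)) *
      (2 * b * ENNReal.ofReal (Real.exp (c / 2 * s)) * (A + κ)) ≤
      2 * b * ENNReal.ofReal (1 / (c / 2)) * (A + κ) := by
    have : ∀ s : ℝ, ENNReal.ofReal (Real.exp (-c * s)) *
        (2 * b * ENNReal.ofReal (Real.exp (c / 2 * s)) * (A + κ)) =
        (2 * b * (A + κ)) * ENNReal.ofReal (Real.exp (-(c / 2) * s)) := by
      intro s
      have : ENNReal.ofReal (Real.exp (-(c / 2) * s)) =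
          ENNReal.ofReal (Real.exp (-c * s)) * ENNReal.ofReal (Real.exp (c / 2 * s)) := by
        rw [← ENNReal.ofReal_mul (Real.exp_pos _).le, ← Real.exp_add]; ring_nf
      rw [this]; ring
    simp_rw [this]
    rw [lintegral_const_mul _ (by fun_prop)]
    calc _ ≤ 2 * b * (A + κ) * ENNReal.ofReal (1 / (c / 2)) := by
          gcongr
          exact lintegral_exp_neg_le (half_pos hc) _ fun s hs => hs.1
      _ = _ := by ring
  calc _ ≤ 2 * (ENNReal.ofReal (Real.exp (-c * t)) ^ 2 * ENNReal.ofReal (Real.exp (c / 2 * t))) *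
        (2 * b) * (A + κ) + 2 * (m ^ 2 * ENNReal.ofReal (1 / c)) *
        (2 * b * ENNReal.ofReal (1 / (c / 2)) * (A + κ)) := by
        refine add_le_add (le_of_eq (by ring)) (mul_le_mul' le_rfl h2)
    _ ≤ 2 * 1 * (2 * b) * (A + κ) + 2 * (m ^ 2 * ENNReal.ofReal (1 / c)) *
        (2 * b * ENNReal.ofReal (1 / (c / 2)) * (A + κ)) := by gcongr
    _ = _ := by ring

/-- By stationarity each instant of a window contributes the same `A`, so Tonelli bounds the drift
integral over a window by `A * s`, and `propagated_le` applies. -/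
lemma lintegral_propagated_le {T : Type*} [MeasurableSpace T] (μ : Measure T)
    [IsProbabilityMeasure μ] {m : ℝ≥0∞} {c : ℝ} (hc : 0 < c) {t : ℝ} (ht : 0 ≤ t)
    {H : T → ℝ → ℝ≥0∞} (hH : Measurable (Function.uncurry H)) {A κ : ℝ≥0∞}
    (hA : ∀ r, ∫⁻ x, H x r ∂μ = A) {J : ℝ → Set ℝ}
    (hJm : MeasurableSet {p : ℝ × ℝ | p.2 ∈ J p.1}) (hJ : ∀ s, volume (J s) ≤ ENNReal.ofReal s) :
    ∫⁻ x, propagated m c t (fun s => 2 * (ENNReal.ofReal s * ∫⁻ r in J s, H x r) +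
      2 * (κ * ENNReal.ofReal s)) ∂μ ≤ propagationConst m c * (A + κ) := by
  have hJs : ∀ s, MeasurableSet (J s) := fun s => measurable_prodMk_left hJm
  have hI : Measurable fun p : T × ℝ => ∫⁻ r in J p.2, H p.1 r := by
    -- The window varies with `s`; writing it as an indicator on the product gives joint
    -- measurability.
    have : Measurable fun q : (T × ℝ) × ℝ =>
        Set.indicator {q : (T × ℝ) × ℝ | q.2 ∈ J q.1.2} (fun q => H q.1.1 q.2) q :=
      Measurable.indicator
        (hH.comp ((measurable_fst.comp measurable_fst).prodMk measurable_snd))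
        (hJm.preimage ((measurable_snd.comp measurable_fst).prodMk measurable_snd))
    convert this.lintegral_prod_right' (ν := volume) using 2 with p
    rw [← lintegral_indicator (hJs p.2)]
    rfl
  have hD : Measurable fun p : T × ℝ => 2 * (ENNReal.ofReal p.2 * ∫⁻ r in J p.2, H p.1 r) +
      2 * (κ * ENNReal.ofReal p.2) := by fun_prop
  have hDs : ∀ s : ℝ, Measurable fun x => 2 * (ENNReal.ofReal s * ∫⁻ r in J s, H x r) +
      2 * (κ * ENNReal.ofReal s) := fun s => hD.comp (measurable_id.prodMk measurable_const)
  have hDle : ∀ s, 0 ≤ s → ∫⁻ x, (2 * (ENNReal.ofReal s * ∫⁻ r in J s, H x r) +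
      2 * (κ * ENNReal.ofReal s)) ∂μ ≤ 2 * (ENNReal.ofReal s * (A * ENNReal.ofReal s)) +
      2 * (κ * ENNReal.ofReal s) := by
    intro s _
    have hIs : Measurable fun x => ∫⁻ r in J s, H x r :=
      hI.comp (measurable_id.prodMk measurable_const)
    rw [lintegral_add_right _ measurable_const, lintegral_const_mul _ (hIs.const_mul _),
      lintegral_const_mul _ hIs, lintegral_lintegral_swap hH.aemeasurable]
    simp only [hA, lintegral_const, measure_univ, mul_one, Measure.restrict_apply_univ]
    gcongr
    exact hJ s
  have hK : Measurable (Function.uncurry fun (x : T) (s : ℝ) =>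
      ENNReal.ofReal (Real.exp (-c * s)) * (2 * (ENNReal.ofReal s * ∫⁻ r in J s, H x r) +
      2 * (κ * ENNReal.ofReal s))) := by
    have : Measurable fun p : T × ℝ => ENNReal.ofReal (Real.exp (-c * p.2)) := by fun_prop
    exact this.mul hD
  have hKi : Measurable fun x => ∫⁻ s in Set.Ioc 0 t,
      ENNReal.ofReal (Real.exp (-c * s)) * (2 * (ENNReal.ofReal s * ∫⁻ r in J s, H x r) +
      2 * (κ * ENNReal.ofReal s)) := hK.lintegral_prod_right'
  refine le_trans ?_ (propagated_le hc ht A κ)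
  unfold propagated
  rw [lintegral_add_right _ (hKi.const_mul _), lintegral_const_mul _ (hDs t),
    lintegral_const_mul _ hKi, lintegral_lintegral_swap hK.aemeasurable]
  refine add_le_add (mul_le_mul' le_rfl (hDle t ht)) (mul_le_mul' le_rfl ?_)
  refine setLIntegral_mono' (μ := volume) (s := Set.Ioc 0 t) measurableSet_Ioc fun s hs => ?_
  rw [lintegral_const_mul _ (hDs s)]
  exact mul_le_mul' le_rfl (hDle s hs.1.le)

end Solution

/-! ### Truncation -/

/-- Only the term to be sent to `0` needs the truncation; the error `q` has a bounded integral and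
is left outside. -/
lemma min_two_mul_add_le (p q : ℝ≥0∞) (N : ℝ≥0∞) :
    min (2 * p + 2 * q) N ≤ 2 * min p N + 2 * q := by
  rcases le_total p N with h | h
  · rw [min_eq_left h]; exact min_le_left _ _
  · rw [min_eq_right h]
    calc min (2 * p + 2 * q) N ≤ N := min_le_right _ _
      _ ≤ 2 * N := le_mul_of_one_le_left' (by norm_num)
      _ ≤ _ := le_self_add

/-- As `∫ |f|²` could be infinite, it cannot be absorbed directly. At fixed `N` the integral on the
right tends to `0` by dominated convergence, with the constant `N` as majorant; monotone convergence
in `N` finishes. -/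
lemma lintegral_enorm_sq_le_of_truncated {T : Type*} [MeasurableSpace T] (μ : Measure T)
    [IsFiniteMeasure μ] {f : T → ℂ} (hf : Measurable f) {c : ℝ} (hc : 0 < c) {B : ℝ≥0∞}
    (h : ∀ N t : ℕ, ∫⁻ x, min (‖f x‖ₑ ^ 2) N ∂μ ≤
      2 * ∫⁻ x, min (ENNReal.ofReal (Real.exp (-c * t)) ^ 2 * ‖f x‖ₑ ^ 2) N ∂μ + 2 * B) :
    ∫⁻ x, ‖f x‖ₑ ^ 2 ∂μ ≤ 2 * B := by
  have hexp : Filter.Tendsto (fun t : ℕ => ENNReal.ofReal (Real.exp (-c * t)) ^ 2)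
      Filter.atTop (nhds 0) := by
    have h1 : Filter.Tendsto (fun t : ℕ => Real.exp (-c * t)) Filter.atTop (nhds 0) :=
      Real.tendsto_exp_atBot.comp
        (tendsto_natCast_atTop_atTop.const_mul_atTop_of_neg (by linarith))
    simpa using ENNReal.Tendsto.pow (n := 2) (ENNReal.tendsto_ofReal h1)
  have htrunc : ∀ N : ℕ, ∫⁻ x, min (‖f x‖ₑ ^ 2) N ∂μ ≤ 2 * B := by
    intro N
    have hlim : Filter.Tendsto (fun t : ℕ => ∫⁻ x,
        min (ENNReal.ofReal (Real.exp (-c * t)) ^ 2 * ‖f x‖ₑ ^ 2) N ∂μ)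
        Filter.atTop (nhds (∫⁻ _, 0 ∂μ)) := by
      refine tendsto_lintegral_of_dominated_convergence (fun _ => (N : ℝ≥0∞))
        (fun t => by fun_prop) (fun t => Filter.Eventually.of_forall fun x => min_le_right _ _)
        (by simp [ENNReal.mul_eq_top]) (Filter.Eventually.of_forall fun x => ?_)
      have := (ENNReal.Tendsto.mul_const hexp (Or.inr (show ‖f x‖ₑ ^ 2 ≠ ∞ by finiteness))).min
        (tendsto_const_nhds (x := (N : ℝ≥0∞)))
      simpa using this
    have hlim2 := (ENNReal.Tendsto.const_mul (a := 2) hlim (by simp)).add_const (2 * B)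
    simp only [lintegral_zero, mul_zero, zero_add] at hlim2
    exact ge_of_tendsto' hlim2 fun t => h N t
  have hsup : ∀ x, ‖f x‖ₑ ^ 2 = ⨆ N : ℕ, min (‖f x‖ₑ ^ 2) (N : ℝ≥0∞) := by
    intro x
    rw [← inf_iSup_eq, ENNReal.iSup_natCast, inf_top_eq]
  rw [lintegral_congr hsup, lintegral_iSup (f := fun (N : ℕ) x => min (‖f x‖ₑ ^ 2) (N : ℝ≥0∞)) (fun N => by fun_prop)
    (fun N N' hNN x => min_le_min le_rfl (by exact_mod_cast hNN))]
  exact iSup_le htrunc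

/-! ### Second moments under an invariant measure -/

section Diffusion

variable {Ω : Type*} [MeasurableSpace Ω] {d : ℕ}

/-- The second moment of the standard Gaussian. -/
noncomputable def gaussianSecondMoment (d : ℕ) : ℝ≥0∞ := ∫⁻ z, ‖z‖ₑ ^ 2 ∂(stdGaussian (E d))

lemma gaussianSecondMoment_lt_top (d : ℕ) : gaussianSecondMoment d < ∞ := by
  have h := (IsGaussian.memLp_two_id (μ := stdGaussian (E d))).2
  have := lintegral_rpow_enorm_lt_top_of_eLpNorm_lt_top (by norm_num) (by norm_num) h
  simpa [gaussianSecondMoment] using this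

lemma IsBrownianMotion.lintegral_functional_sub_sq_le {P : Measure Ω} {W : ℝ≥0 → Ω → E d}
    (hW : IsBrownianMotion P W) (l : E d →L[ℝ] ℂ) {s t : ℝ≥0} (hst : s ≤ t) :
    ∫⁻ ω, ‖l (W t ω - W s ω)‖ₑ ^ 2 ∂P ≤
      ‖l‖ₑ ^ 2 * gaussianSecondMoment d * ENNReal.ofReal ((t : ℝ) - s) := by
  calc ∫⁻ ω, ‖l (W t ω - W s ω)‖ₑ ^ 2 ∂P ≤ ∫⁻ ω, ‖l‖ₑ ^ 2 * ‖W t ω - W s ω‖ₑ ^ 2 ∂P := by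
        refine lintegral_mono fun ω => ?_
        rw [← mul_pow]
        gcongr
        exact l.le_opENorm _
    _ = ‖l‖ₑ ^ 2 * ∫⁻ ω, ‖W t ω - W s ω‖ₑ ^ 2 ∂P :=
        lintegral_const_mul _ (((hW.measurable t).sub (hW.measurable s)).enorm.pow_const 2)
    _ = ‖l‖ₑ ^ 2 * ∫⁻ z, ‖Real.sqrt ((t : ℝ) - s) • z‖ₑ ^ 2 ∂(stdGaussian (E d)) := by
        rw [(hW.law s t hst).lintegral_comp (f := fun z => ‖z‖ₑ ^ 2) (by fun_prop),
          lintegral_map (by fun_prop) (by fun_prop)]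
    _ = _ := by
        simp_rw [enorm_smul, mul_pow]
        rw [lintegral_const_mul _ (by fun_prop), gaussianSecondMoment, ← ofReal_norm (Real.sqrt _),
          ← ENNReal.ofReal_pow (norm_nonneg _), Real.norm_eq_abs, sq_abs,
          Real.sq_sqrt (sub_nonneg.2 (by exact_mod_cast hst))]
        ring

/-- An invariant probability measure comes with regular versions of the solutions, with laws
depending measurably on the initial point. -/
lemma IsInvariantProbability.exists_regular_solutions {P : Measure Ω} [IsProbabilityMeasure P]
    {W : ℝ≥0 → Ω → E d} (hWm : ∀ t, Measurable (W t)) {M : Matrix (Fin d) (Fin d) ℝ}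
    {v : E d → E d} (hv : HasUniqueStrongSolution P W M v) {μ : Measure (E d)}
    (hμ : IsInvariantProbability P W M v μ) :
    ∃ X : E d → ℝ≥0 → Ω → E d, (∀ x ω, Continuous fun t => X x t ω) ∧
      (∀ x t, Measurable (X x t)) ∧
      (∀ x, ∀ᵐ ω ∂P, ∀ t : ℝ≥0,
        X x t ω = x + (∫ s in (0 : ℝ)..(t : ℝ), drift M v (X x s.toNNReal ω)) + W t ω) ∧
      ∀ t, AEMeasurable (fun x => P.map (X x t)) μ ∧ μ.bind (fun x => P.map (X x t)) = μ := by
  choose Y hY _ using hv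
  have hpast : ∀ t, past W t ≤ ‹MeasurableSpace Ω› := fun t =>
    iSup₂_le fun r _ => (hWm r).comap_le
  have hmod := fun x => exists_continuous_measurable_modification P
    (fun t => (((hY x).adapted t).mono (hpast t)).aemeasurable) (hY x).continuous
  choose X hXc hXm hXY using hmod
  have hbind : ∀ t, μ.bind (fun x => P.map (X x t)) = μ := by
    intro t
    have : ∀ x, P.map (X x t) = P.map (Y x t) := fun x =>
      Measure.map_congr ((hXY x).mono fun ω hω => hω t)
    simp_rw [this]
    exact hμ.2 Y hY t
  refine ⟨X, hXc, hXm, fun x => ?_, fun t => ⟨?_, hbind t⟩⟩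
  · filter_upwards [hXY x, (hY x).equation] with ω h1 h2 t
    simp_rw [h1]
    exact h2 t
  -- Otherwise `Measure.bind` would be the zero measure, whereas it equals the probability measure
  -- `μ`.
  · by_contra hne
    have h0 := hbind t
    rw [Measure.bind, Measure.map_of_not_aemeasurable hne, Measure.join_zero] at h0
    have := hμ.1
    exact IsProbabilityMeasure.ne_zero μ h0.symm

/-- Second moment of an approximate left eigenfunctional under an invariant probability measure. -/
lemma IsInvariantProbability.lintegral_functional_sq_le {P : Measure Ω} [IsProbabilityMeasure P]
    {W : ℝ≥0 → Ω → E d} (hW : IsBrownianMotion P W) {M : Matrix (Fin d) (Fin d) ℝ}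
    {v : E d → E d} (hv : IsStabilisingControl P W M v) {μ : Measure (E d)}
    (hμ : IsInvariantProbability P W M v μ) {l : E d →L[ℝ] ℂ} {lam : ℂ} (hlam : lam.re ≠ 0)
    {u : E d → ℂ} (hum : Measurable u) (hu : ∀ x, l (drift M v x) = lam * l x + u x) :
    ∫⁻ x, ‖l x‖ₑ ^ 2 ∂μ ≤ 2 * (propagationConst ‖lam‖ₑ |lam.re| *
      (∫⁻ x, ‖u x‖ₑ ^ 2 ∂μ + ‖l‖ₑ ^ 2 * gaussianSecondMoment d)) := by
  have := hμ.1
  have hc : 0 < |lam.re| := abs_pos.2 hlam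
  have hlm : Measurable l := l.continuous.measurable
  obtain ⟨X, hXc, hXm, heq, hbind⟩ := hμ.exists_regular_solutions hW.measurable hv.uniqueSolution
  have hstat : ∀ {φ : E d → ℝ≥0∞}, Measurable φ → ∀ t,
      ∫⁻ x, ∫⁻ ω, φ (X x t ω) ∂P ∂μ = ∫⁻ x, φ x ∂μ := by
    intro φ hφ t
    conv_rhs => rw [← (hbind t).2]
    rw [Measure.lintegral_bind (hbind t).1 hφ.aemeasurable]
    simp_rw [lintegral_map hφ (hXm _ t)]
  have hstatm : ∀ {φ : E d → ℝ≥0∞}, Measurable φ → ∀ t,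
      AEMeasurable (fun x => ∫⁻ ω, φ (X x t ω) ∂P) μ := by
    intro φ hφ t
    have := (Measure.measurable_lintegral hφ).comp_aemeasurable (hbind t).1
    refine this.congr (Filter.Eventually.of_forall fun x => ?_)
    exact lintegral_map hφ (hXm x t)
  -- Exchanging the integrals over the initial point and over time needs laws measurable jointly in
  -- both.
  obtain ⟨κ', hκm, hκ⟩ := exists_jointly_measurable_kernel μ
    (κ := fun t x => P.map (X x t))
    (fun t x => Measure.isProbabilityMeasure_map (hXm x t).aemeasurable) (fun t => (hbind t).1)
    (fun g x => continuous_lintegral_map P (hXc x) (hXm x) g)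
  have hu2 : Measurable fun x => ‖u x‖ₑ ^ 2 := hum.enorm.pow_const 2
  let H : E d → ℝ → ℝ≥0∞ := fun x r => ∫⁻ z, ‖u z‖ₑ ^ 2 ∂κ' r.toNNReal x
  have hH : Measurable (Function.uncurry H) :=
    (Measure.measurable_lintegral hu2).comp
      (hκm.comp ((measurable_real_toNNReal.comp measurable_snd).prodMk measurable_fst))
  have hHX : ∀ᵐ x ∂μ, ∀ r : ℝ, ∫⁻ ω, ‖u (X x r.toNNReal ω)‖ₑ ^ 2 ∂P = H x r := by
    filter_upwards [hκ] with x hx r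
    simp only [H]
    rw [hx, lintegral_map hu2 (hXm _ _)]
  have hHA : ∀ r, ∫⁻ x, H x r ∂μ = ∫⁻ x, ‖u x‖ₑ ^ 2 ∂μ := by
    intro r
    rw [← hstat hu2 r.toNNReal]
    exact lintegral_congr_ae (hHX.mono fun x hx => (hx r).symm)
  refine lintegral_enorm_sq_le_of_truncated μ hlm hc fun N t => ?_
  obtain ⟨a, b, e, J, he, hJm, hJ, hbound⟩ := exists_mean_square_bound (P := P) hW.measurable
    hv.measurable hv.locallyBounded hlam hum hu
    (fun s t hst => hW.lintegral_functional_sub_sq_le l hst) (Nat.cast_nonneg t)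
  have hφ : Measurable fun x => min (‖l x‖ₑ ^ 2) (N : ℝ≥0∞) := by fun_prop
  have hψ : Measurable fun x => min (ENNReal.ofReal (Real.exp (-|lam.re| * t)) ^ 2 * ‖l x‖ₑ ^ 2)
      (N : ℝ≥0∞) := by fun_prop
  -- Invariance is used at time `a` to introduce the solution and at time `b` to remove it again.
  calc ∫⁻ x, min (‖l x‖ₑ ^ 2) (N : ℝ≥0∞) ∂μ
      = ∫⁻ x, ∫⁻ ω, min (‖l (X x a ω)‖ₑ ^ 2) (N : ℝ≥0∞) ∂P ∂μ := (hstat hφ a).symm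
    _ ≤ ∫⁻ x, (2 * ∫⁻ ω, min (ENNReal.ofReal (Real.exp (-|lam.re| * t)) ^ 2 *
          ‖l (X x b ω)‖ₑ ^ 2) (N : ℝ≥0∞) ∂P +
        2 * propagated ‖lam‖ₑ |lam.re| t (fun s => 2 * (ENNReal.ofReal s * ∫⁻ r in J s, H x r) +
          2 * (‖l‖ₑ ^ 2 * gaussianSecondMoment d * ENNReal.ofReal s))) ∂μ := by
        refine lintegral_mono_ae ?_
        filter_upwards [hHX] with x hx
        have hb := hbound x (X x) (hXc x) (hXm x) (heq x)
        simp_rw [hx] at hb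
        have hmb : Measurable fun ω => min (ENNReal.ofReal (Real.exp (-|lam.re| * t)) ^ 2 *
          ‖l (X x b ω)‖ₑ ^ 2) (N : ℝ≥0∞) := hψ.comp (hXm x b)
        have hmd : Measurable fun ω => ‖l (X x a ω) - e * l (X x b ω)‖ₑ ^ 2 :=
          ((hlm.comp (hXm x a)).sub ((hlm.comp (hXm x b)).const_mul e)).enorm.pow_const 2
        calc _ ≤ ∫⁻ ω, (2 * min (ENNReal.ofReal (Real.exp (-|lam.re| * t)) ^ 2 *
              ‖l (X x b ω)‖ₑ ^ 2) (N : ℝ≥0∞) + 2 * ‖l (X x a ω) - e * l (X x b ω)‖ₑ ^ 2) ∂P := by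
              refine lintegral_mono fun ω =>
                le_trans (min_le_min ?_ le_rfl) (min_two_mul_add_le _ _ _)
              rw [← he, ← mul_pow, ← enorm_mul]
              calc _ = ‖e * l (X x b ω) + (l (X x a ω) - e * l (X x b ω))‖ₑ ^ 2 := by
                    rw [add_sub_cancel]
                _ ≤ _ := enorm_add_sq_le _ _
          _ = _ := by
              rw [lintegral_add_left (hmb.const_mul 2), lintegral_const_mul _ hmb,
                lintegral_const_mul _ hmd]
          _ ≤ _ := add_le_add le_rfl (mul_le_mul' le_rfl hb)
    _ = 2 * ∫⁻ x, min (ENNReal.ofReal (Real.exp (-|lam.re| * t)) ^ 2 * ‖l x‖ₑ ^ 2)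
          (N : ℝ≥0∞) ∂μ +
        2 * ∫⁻ x, propagated ‖lam‖ₑ |lam.re| t (fun s =>
          2 * (ENNReal.ofReal s * ∫⁻ r in J s, H x r) +
          2 * (‖l‖ₑ ^ 2 * gaussianSecondMoment d * ENNReal.ofReal s)) ∂μ := by
        rw [lintegral_add_left' ((hstatm hψ b).const_mul 2),
          lintegral_const_mul' _ _ (by simp), lintegral_const_mul' _ _ (by simp), hstat hψ b]
    _ ≤ _ := by
        gcongr
        exact lintegral_propagated_le μ hc (Nat.cast_nonneg t) hH hHA hJm hJ

end Diffusion

/-! ### From generalized eigenfunctionals to the norm -/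

section Algebra

variable {d : ℕ}

/-- The functional `x ↦ ∑ aᵢ xᵢ` with complex coefficients. -/
noncomputable def functional (a : Fin d → ℂ) : E d →L[ℝ] ℂ :=
  ∑ i, a i • (Complex.ofRealCLM ∘L EuclideanSpace.proj i)

lemma functional_apply (a : Fin d → ℂ) (x : E d) : functional a x = ∑ i, a i * (x i : ℂ) := by
  simp [functional]

lemma functional_add (a b : Fin d → ℂ) (x : E d) :
    functional (a + b) x = functional a x + functional b x := by
  simp [functional_apply, add_mul, Finset.sum_add_distrib]

lemma functional_smul (c : ℂ) (a : Fin d → ℂ) (x : E d) :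
    functional (c • a) x = c * functional a x := by
  simp [functional_apply, mul_assoc, Finset.mul_sum]

/-- The complexified transpose of `M`, acting on the coefficients of functionals. -/
noncomputable def dualEnd (M : Matrix (Fin d) (Fin d) ℝ) : Module.End ℂ (Fin d → ℂ) :=
  Matrix.toLin' (M.map (algebraMap ℝ ℂ)).transpose

lemma functional_toEuclideanLin (M : Matrix (Fin d) (Fin d) ℝ) (a : Fin d → ℂ) (x : E d) :
    functional a (Matrix.toEuclideanLin M x) = functional (dualEnd M a) x := by
  simp only [functional_apply, dualEnd, Matrix.toLin'_apply, Matrix.mulVec, dotProduct,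
    Matrix.transpose_apply, Matrix.map_apply, Matrix.toLpLin_apply, Finset.mul_sum, Finset.sum_mul,
    Complex.ofReal_sum, Complex.ofReal_mul, Complex.coe_algebraMap]
  rw [Finset.sum_comm]
  refine Finset.sum_congr rfl fun i _ => Finset.sum_congr rfl fun j _ => ?_
  ring

/-- Transposition preserves the spectrum; hence purely imaginary numbers have no generalized
eigenvectors. -/
lemma isUnit_dualEnd_sub {M : Matrix (Fin d) (Fin d) ℝ} (hM : IsExponentiallyDichotomous M)
    {lam : ℂ} (hlam : lam.re = 0) : IsUnit (dualEnd M - algebraMap ℂ _ lam) := by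
  have h : lam ∉ spectrum ℂ (M.map (algebraMap ℝ ℂ)) := fun hs => hM lam hs hlam
  have h2 : lam ∉ spectrum ℂ (dualEnd M) := by
    rw [spectrum.notMem_iff] at h
    rw [dualEnd, Matrix.spectrum_toLin', spectrum.notMem_iff, ← Matrix.isUnit_transpose]
    simpa [Algebra.algebraMap_eq_smul_one] using h
  simpa using (spectrum.notMem_iff.1 h2).neg

/-- Functionals whose second moment is controlled by the control effort, uniformly over a family of
measures and controls. -/
def boundedFunctionals (S : Set (Measure (E d) × (E d → E d))) : Submodule ℂ (Fin d → ℂ) where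
  carrier := {a | ∃ C : ℝ≥0, ∀ p ∈ S,
    ∫⁻ x, ‖functional a x‖ₑ ^ 2 ∂p.1 ≤ C * (1 + ∫⁻ x, ‖p.2 x‖ₑ ^ 2 ∂p.1)}
  zero_mem' := ⟨0, fun p _ => by simp [functional_apply]⟩
  add_mem' := by
    rintro a b ⟨C, hC⟩ ⟨C', hC'⟩
    refine ⟨2 * C + 2 * C', fun p hp => ?_⟩
    calc ∫⁻ x, ‖functional (a + b) x‖ₑ ^ 2 ∂p.1
        ≤ ∫⁻ x, (2 * ‖functional a x‖ₑ ^ 2 + 2 * ‖functional b x‖ₑ ^ 2) ∂p.1 :=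
          lintegral_mono fun x => by rw [functional_add]; exact enorm_add_sq_le _ _
      _ = 2 * ∫⁻ x, ‖functional a x‖ₑ ^ 2 ∂p.1 + 2 * ∫⁻ x, ‖functional b x‖ₑ ^ 2 ∂p.1 := by
          rw [lintegral_add_left (by fun_prop), lintegral_const_mul _ (by fun_prop),
            lintegral_const_mul _ (by fun_prop)]
      _ ≤ 2 * (C * (1 + ∫⁻ x, ‖p.2 x‖ₑ ^ 2 ∂p.1)) +
          2 * (C' * (1 + ∫⁻ x, ‖p.2 x‖ₑ ^ 2 ∂p.1)) := by gcongr <;> simp_all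
      _ = _ := by push_cast; ring
  smul_mem' := by
    rintro c a ⟨C, hC⟩
    refine ⟨‖c‖₊ ^ 2 * C, fun p hp => ?_⟩
    simp_rw [functional_smul, enorm_mul, mul_pow]
    rw [lintegral_const_mul _ (by fun_prop)]
    push_cast
    rw [mul_assoc]
    exact mul_le_mul' le_rfl (hC p hp)

/-- One step up a Jordan chain: from `dualEnd M a = lam • a + a'`, the functional of `a` satisfies
the scalar equation with `u` the functional of `a'` plus that of `a` applied to the control, both
already controlled. -/
lemma mem_boundedFunctionals_of_dualEnd {M : Matrix (Fin d) (Fin d) ℝ}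
    {S : Set (Measure (E d) × (E d → E d))} (hS : ∀ p ∈ S, Measurable p.2)
    (hest : ∀ (l : E d →L[ℝ] ℂ) (lam : ℂ), lam.re ≠ 0 → ∃ K : ℝ≥0, ∀ p ∈ S, ∀ u : E d → ℂ,
      Measurable u → (∀ x, l (drift M p.2 x) = lam * l x + u x) →
      ∫⁻ x, ‖l x‖ₑ ^ 2 ∂p.1 ≤ K * (1 + ∫⁻ x, ‖u x‖ₑ ^ 2 ∂p.1))
    {lam : ℂ} (hlam : lam.re ≠ 0) {a : Fin d → ℂ}
    (ha : (dualEnd M - algebraMap ℂ _ lam) a ∈ boundedFunctionals S) :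
    a ∈ boundedFunctionals S := by
  obtain ⟨C, hC⟩ := ha
  obtain ⟨K, hK⟩ := hest (functional a) lam hlam
  set a' := (dualEnd M - algebraMap ℂ _ lam) a with ha'
  have haa : dualEnd M a = lam • a + a' := by
    rw [ha', LinearMap.sub_apply, Module.algebraMap_end_apply]; abel
  refine ⟨K * (1 + (2 * C + 2 * ‖functional a‖₊ ^ 2)), fun p hp => ?_⟩
  have hv := hS p hp
  set V := ∫⁻ x, ‖p.2 x‖ₑ ^ 2 ∂p.1
  have hu : ∫⁻ x, ‖functional a' x + functional a (p.2 x)‖ₑ ^ 2 ∂p.1 ≤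
      2 * (C * (1 + V)) + 2 * (‖functional a‖ₑ ^ 2 * V) := by
    calc _ ≤ ∫⁻ x, (2 * ‖functional a' x‖ₑ ^ 2 +
          2 * (‖functional a‖ₑ ^ 2 * ‖p.2 x‖ₑ ^ 2)) ∂p.1 := by
          refine lintegral_mono fun x => (enorm_add_sq_le _ _).trans ?_
          rw [← mul_pow]
          gcongr
          exact (functional a).le_opENorm _
      _ = 2 * ∫⁻ x, ‖functional a' x‖ₑ ^ 2 ∂p.1 + 2 * (‖functional a‖ₑ ^ 2 * V) := by
          have hv2 : Measurable fun x => ‖p.2 x‖ₑ ^ 2 := hv.enorm.pow_const 2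
          rw [lintegral_add_left (by fun_prop), lintegral_const_mul _ (by fun_prop),
            lintegral_const_mul _ (hv2.const_mul _), lintegral_const_mul _ hv2]
      _ ≤ _ := by gcongr; exact hC p hp
  refine (hK p hp (fun x => functional a' x + functional a (p.2 x))
    ((functional a').continuous.measurable.add ((functional a).continuous.measurable.comp hv))
    fun x => ?_).trans ?_
  · rw [drift, map_add, functional_toEuclideanLin, haa, functional_add, functional_smul]; ring
  · push_cast
    rw [mul_assoc]
    gcongr
    calc _ ≤ (1 : ℝ≥0∞) * (1 + V) + (2 * (C * (1 + V)) + 2 * (‖functional a‖ₑ ^ 2 * (1 + V))) := by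
          refine add_le_add (by rw [one_mul]; exact le_self_add) (hu.trans ?_)
          gcongr
          exact le_add_self
      _ = _ := by rw [enorm_eq_nnnorm]; ring

lemma boundedFunctionals_eq_top {M : Matrix (Fin d) (Fin d) ℝ} (hM : IsExponentiallyDichotomous M)
    {S : Set (Measure (E d) × (E d → E d))} (hS : ∀ p ∈ S, Measurable p.2)
    (hest : ∀ (l : E d →L[ℝ] ℂ) (lam : ℂ), lam.re ≠ 0 → ∃ K : ℝ≥0, ∀ p ∈ S, ∀ u : E d → ℂ,
      Measurable u → (∀ x, l (drift M p.2 x) = lam * l x + u x) →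
      ∫⁻ x, ‖l x‖ₑ ^ 2 ∂p.1 ≤ K * (1 + ∫⁻ x, ‖u x‖ₑ ^ 2 ∂p.1)) :
    boundedFunctionals S = ⊤ := by
  rw [eq_top_iff, ← Module.End.iSup_maxGenEigenspace_eq_top (dualEnd M)]
  refine iSup_le fun lam a ha => ?_
  obtain ⟨k, hk⟩ := (Module.End.mem_maxGenEigenspace _ _ _).1 ha
  rw [← Algebra.algebraMap_eq_smul_one] at hk
  by_cases hlam : lam.re = 0
  · have hinj := ((Module.End.isUnit_iff _).1 ((isUnit_dualEnd_sub hM hlam).pow k)).1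
    rw [hinj (hk.trans (map_zero _).symm)]
    exact zero_mem _
  -- Induction on the power `k` of `dualEnd M - lam` that kills `a`: its image under one factor is
  -- killed by one power fewer.
  · clear ha
    induction k generalizing a with
    | zero => rw [pow_zero, Module.End.one_apply] at hk; rw [hk]; exact zero_mem _
    | succ k ih =>
      rw [pow_succ, Module.End.mul_apply] at hk
      exact mem_boundedFunctionals_of_dualEnd hS hest hlam (ih _ hk)

lemma exists_lintegral_norm_sq_le {M : Matrix (Fin d) (Fin d) ℝ}
    (hM : IsExponentiallyDichotomous M)
    {S : Set (Measure (E d) × (E d → E d))} (hS : ∀ p ∈ S, Measurable p.2)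
    (hest : ∀ (l : E d →L[ℝ] ℂ) (lam : ℂ), lam.re ≠ 0 → ∃ K : ℝ≥0, ∀ p ∈ S, ∀ u : E d → ℂ,
      Measurable u → (∀ x, l (drift M p.2 x) = lam * l x + u x) →
      ∫⁻ x, ‖l x‖ₑ ^ 2 ∂p.1 ≤ K * (1 + ∫⁻ x, ‖u x‖ₑ ^ 2 ∂p.1)) :
    ∃ C : ℝ≥0, ∀ p ∈ S, ∫⁻ x, ‖x‖ₑ ^ 2 ∂p.1 ≤ C * (1 + ∫⁻ x, ‖p.2 x‖ₑ ^ 2 ∂p.1) := by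
  have hmem : ∀ i : Fin d, Pi.single i 1 ∈ boundedFunctionals S := fun i => by
    rw [boundedFunctionals_eq_top hM hS hest]; trivial
  choose C hC using hmem
  refine ⟨∑ i, C i, fun p hp => ?_⟩
  have hsq : ∀ x : E d, ‖x‖ₑ ^ 2 = ∑ i, ‖functional (Pi.single i 1) x‖ₑ ^ 2 := by
    intro x
    simp_rw [← ofReal_norm, ← ENNReal.ofReal_pow (norm_nonneg _)]
    rw [← ENNReal.ofReal_sum_of_nonneg fun _ _ => by positivity, EuclideanSpace.norm_sq_eq]
    simp [functional_apply, Pi.single_apply]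
  rw [lintegral_congr hsq, lintegral_finsetSum _ fun i _ => by fun_prop, ENNReal.ofNNReal_finsetSum, Finset.sum_mul]
  exact Finset.sum_le_sum fun i _ => hC i p hp

end Algebra

end LQG

theorem lemma1p16 {d : ℕ} (M : Matrix (Fin d) (Fin d) ℝ)
    (hM : LQG.IsExponentiallyDichotomous M) :
    ∃ C : ℝ≥0, ∀ (Ω : Type*) [MeasurableSpace Ω] (P : Measure Ω) [IsProbabilityMeasure P]
      (W : ℝ≥0 → Ω → LQG.E d), LQG.IsBrownianMotion P W →
      ∀ v : LQG.E d → LQG.E d, LQG.IsStabilisingControl P W M v →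
      ∀ μ : Measure (LQG.E d), LQG.IsInvariantProbability P W M v μ →
        ∫⁻ x, ‖x‖ₑ ^ 2 ∂μ ≤ (C : ℝ≥0∞) * (1 + ∫⁻ x, ‖v x‖ₑ ^ 2 ∂μ) := by
  obtain ⟨C, hC⟩ := LQG.exists_lintegral_norm_sq_le hM
    -- All probability spaces, Brownian motions and controls are gathered in one family, so that the
    -- constant depends on `M` (and `d`) alone.
    (S := {p | ∃ (Ω : Type _) (_ : MeasurableSpace Ω) (P : Measure Ω) (_ : IsProbabilityMeasure P)
      (W : ℝ≥0 → Ω → LQG.E d), LQG.IsBrownianMotion P W ∧ LQG.IsStabilisingControl P W M p.2 ∧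
      LQG.IsInvariantProbability P W M p.2 p.1})
    (by rintro p ⟨Ω, _, P, _, W, hW, hv, hμ⟩; exact hv.measurable)
    (by
      intro l lam hlam
      have hg := LQG.gaussianSecondMoment_lt_top d
      have hp := LQG.propagationConst_lt_top (m := ‖lam‖ₑ) (by finiteness) |lam.re|
      -- Chosen through `A + κ ≤ (1 + κ) * (1 + A)`, with `A` the second moment of `u` and `κ` the
      -- noise constant.
      refine ⟨(2 * (LQG.propagationConst ‖lam‖ₑ |lam.re| *
        (1 + ‖l‖ₑ ^ 2 * LQG.gaussianSecondMoment d))).toNNReal, ?_⟩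
      rintro p ⟨Ω, _, P, _, W, hW, hv, hμ⟩ u hum hu
      refine (hμ.lintegral_functional_sq_le hW hv hlam hum hu).trans ?_
      rw [ENNReal.coe_toNNReal (by finiteness), mul_assoc 2, mul_assoc (LQG.propagationConst _ _)]
      refine mul_le_mul' le_rfl (mul_le_mul' le_rfl ?_)
      rw [add_mul, one_mul]
      exact add_le_add le_add_self (le_mul_of_one_le_right' le_self_add))
  exact ⟨C, fun Ω _ P hP W hW v hv μ hμ => hC (μ, v) ⟨Ω, _, P, hP, W, hW, hv, hμ⟩⟩
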